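/- Let $q\equiv 1\pmod 4$ be a power of an odd prime, let $n=q^2+1$, $s=n/2$ and $F=\mathbb F_{q^2}$. A convolutional code with parameters $(n,k,\gamma;\mu,d)_{q^2}$ is a submodule $W=\{u(D)G(D): u(D)\in F[D]^k\}$ of $F[D]^n$, where $G(D)\in F[D]^{k\times n}$ is basic (it has a polynomial right inverse) and reduced (the sum $\gamma$ of the row degrees $\gamma_1,\dots,\gamma_k$ is smallest among all basic generator matrices of $W$), $\mu=\max_a\gamma_a$, and $d$ is the smallest number of nonzero coefficients of a nonzero element of $W$. The code is MDS if it attains the generalized Singleton bound, $d=(n-k)(\lfloor\gamma/k\rfloor+1)+\gamma+1$. Then for every integer $i$ with $2\le i\le n/2-1$ there is an MDS convolutional code $W$ over $F$ with parameters $$(n,\;n-2i+1,\;2;\;1,\;2i+2)_{q^2}.$$ Moreover $W$ can be taken of the following form. For a suitable primitive $2n$-th root of unity $\beta$ in an extension of $F$, let $M^{(j)}(x)$ be the minimal polynomial of $\beta^j$ over $F$, and let $C_2\subseteq C_1$ and $C_0$ be the negacyclic (BCH) codes of length $n$ over $F$ generated in $F[x]/(x^n+1)$ by $\operatorname{lcm}\{M^{(s)},M^{(s+2)},\dots,M^{(s+2i)}\}$,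 $\operatorname{lcm}\{M^{(s)},M^{(s+2)},\dots,M^{(s+2(i-1))}\}$ and $M^{(s+2i)}$ respectively. There are full-rank parity check matrices $H_{C_1}$ of $C_1$ (with $2i-1$ rows) and $H_{C_0}$ of $C_0$ (with $2$ rows) which, stacked, form a full-rank parity check matrix of $C_2$, such that, $\tilde H_{C_0}$ being $H_{C_0}$ with $2i-3$ zero rows added at the bottom, the matrix $G(D)=H_{C_1}+\tilde H_{C_0}D$ is reduced basic and generates a convolutional code $V$ of dimension $2i-1$, degree $2$ and memory $1$, and $W$ is the Hermitian dual of $V$, that is, $$W=\Big\{u(D)\in F[D]^n:\ \sum_m (D^l u)_m\cdot v_m^{\,q}=0\ \text{ for all } l\ge 0 \text{ and all } v(D)\in V\Big\},$$ where $w_m\in F^n$ denotes the vector of coefficients of $D^m$ in $w(D)$, $v_m^{\,q}$ is the entrywise $q$-th power, and $\cdot$ is the standard bilinear product on $F^n$. -/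

import Mathlib

open Polynomial

namespace ConvCode

/-! ### Block codes -/

section Block

variable {F : Type*} [Field F]

/-- The polynomial `c 0 + c 1 * x + ... + c (n-1) * x ^ (n-1)` attached to a word `c`. -/
noncomputable def wordPoly {n : ℕ} (c : Fin n → F) : F[X] :=
  ∑ j : Fin n, C (c j) * X ^ (j : ℕ)

/-- The negacyclic code of length `n` generated by `g`: the words whose class in
`F[x] / (x ^ n + 1)` lies in the principal ideal generated by the class of `g`. -/
def negacyclicCode (n : ℕ) (g : F[X]) : Set (Fin n → F) :=
  {c | Ideal.Quotient.mk (Ideal.span {(X ^ n + 1 : F[X])}) (wordPoly c) ∈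
    Ideal.span {Ideal.Quotient.mk (Ideal.span {(X ^ n + 1 : F[X])}) g}}

open Classical in
/-- The monic least common multiple of the minimal polynomials over `F` of
`β ^ b, β ^ (b + 2), ..., β ^ (b + 2 * (δ - 2))`. -/
noncomputable def bchGenerator {K : Type*} [Field K] [Algebra F K] (β : K) (b δ : ℕ) : F[X] :=
  letI : NormalizedGCDMonoid F[X] := UniqueFactorizationMonoid.toNormalizedGCDMonoid F[X]
  (Finset.range (δ - 1)).lcm (fun t => minpoly F (β ^ (b + 2 * t)))

/-- The negacyclic BCH code over `F` of length `n` and designed distance `δ` with zeros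
`β ^ b, β ^ (b + 2), ..., β ^ (b + 2 * (δ - 2))`. -/
noncomputable def negacyclicBCH (F : Type*) [Field F] {K : Type*} [Field K] [Algebra F K]
    (n : ℕ) (β : K) (b δ : ℕ) : Set (Fin n → F) :=
  negacyclicCode n (bchGenerator (F := F) β b δ)

/-- `H` is a (full rank) parity check matrix of the block code `B`. -/
def IsParityCheck {n : ℕ} {ι : Type*} (H : Matrix ι (Fin n) F) (B : Set (Fin n → F)) : Prop :=
  LinearIndependent F H.row ∧ ∀ c : Fin n → F, c ∈ B ↔ H.mulVec c = 0

end Block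

/-! ### Convolutional codes -/

section Conv

variable {F : Type*} [Field F] {k n : ℕ}

/-- A polynomial matrix is basic if it has a polynomial right inverse. -/
def IsBasic (G : Matrix (Fin k) (Fin n) F[X]) : Prop :=
  ∃ R : Matrix (Fin n) (Fin k) F[X], G * R = 1

/-- The submodule `{u(D) G(D)}` of `F[D]^n` generated by `G(D)`. -/
noncomputable def generated (G : Matrix (Fin k) (Fin n) F[X]) :
    Submodule F[X] (Fin n → F[X]) :=
  LinearMap.range G.vecMulLinear

/-- The `a`-th constraint length: the largest degree in the `a`-th row. -/
noncomputable def constraintLength (G : Matrix (Fin k) (Fin n) F[X]) (a : Fin k) : ℕ :=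
  Finset.univ.sup (fun j => (G a j).natDegree)

/-- The overall constraint length: the sum of the constraint lengths. -/
noncomputable def overallConstraintLength (G : Matrix (Fin k) (Fin n) F[X]) : ℕ :=
  ∑ a, constraintLength G a

/-- The memory: the largest constraint length. -/
noncomputable def memory (G : Matrix (Fin k) (Fin n) F[X]) : ℕ :=
  Finset.univ.sup (constraintLength G)

/-- A basic matrix is reduced if its overall constraint length is the smallest one among all
basic generator matrices of the same code. -/
def IsReducedBasic (G : Matrix (Fin k) (Fin n) F[X]) : Prop :=
  IsBasic G ∧ ∀ G' : Matrix (Fin k) (Fin n) F[X], IsBasic G' → generated G' = generated G →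
    overallConstraintLength G ≤ overallConstraintLength G'

/-- The weight of a polynomial vector: its number of nonzero coefficients. -/
def weight (v : Fin n → F[X]) : ℕ := ∑ j, (v j).support.card

/-- `d` is the free distance of `V`. -/
def HasFreeDistance (V : Submodule F[X] (Fin n → F[X])) (d : ℕ) : Prop :=
  IsLeast {w | ∃ v ∈ V, v ≠ 0 ∧ weight v = w} d

/-- `G` is a reduced basic generator matrix of `V` with degree `γ` and memory `μ`; thus `V` is an
`(n, k, γ; μ)` convolutional code. -/
def IsGeneratorWith (G : Matrix (Fin k) (Fin n) F[X]) (V : Submodule F[X] (Fin n → F[X]))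
    (γ μ : ℕ) : Prop :=
  IsReducedBasic G ∧ V = generated G ∧ overallConstraintLength G = γ ∧ memory G = μ

/-- `V` is a convolutional code with parameters `(n, k, γ; μ, d)`. -/
def HasParameters (V : Submodule F[X] (Fin n → F[X])) (k γ μ d : ℕ) : Prop :=
  (∃ G : Matrix (Fin k) (Fin n) F[X], IsGeneratorWith G V γ μ) ∧ HasFreeDistance V d

/-- `V` is an MDS convolutional code: its parameters satisfy the generalized Singleton bound
`d ≤ (n - k) (⌊γ / k⌋ + 1) + γ + 1` with equality. -/
def IsMDS (V : Submodule F[X] (Fin n → F[X])) : Prop :=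
  ∃ k γ μ d : ℕ, HasParameters V k γ μ d ∧ d = (n - k) * (γ / k + 1) + γ + 1

/-- The Hermitian inner product `∑ m, u_m · v_m ^ q` of two polynomial vectors, where `u_m`, `v_m`
are the vectors of coefficients of `D ^ m`. -/
noncomputable def hermitianInner (q : ℕ) (u v : Fin n → F[X]) : F :=
  ∑ j, (u j).sum (fun m a => a * (v j).coeff m ^ q)

theorem hermitianInner_add (q : ℕ) (u u' v : Fin n → F[X]) :
    hermitianInner q (u + u') v = hermitianInner q u v + hermitianInner q u' v := by
  unfold hermitianInner
  rw [← Finset.sum_add_distrib]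
  refine Finset.sum_congr rfl fun j _ => ?_
  exact Polynomial.sum_add_index _ _ _ (fun _ => zero_mul _) (fun _ _ _ => add_mul _ _ _)

theorem hermitianInner_C_smul (q : ℕ) (a : F) (u v : Fin n → F[X]) :
    hermitianInner q ((C a : F[X]) • u) v = a * hermitianInner q u v := by
  unfold hermitianInner
  rw [Finset.mul_sum]
  refine Finset.sum_congr rfl fun j _ => ?_
  rw [Pi.smul_apply, smul_eq_mul, ← Polynomial.smul_eq_C_mul,
    Polynomial.sum_smul_index _ _ _ (fun _ => zero_mul _), Polynomial.sum_def, Polynomial.sum_def,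
    Finset.mul_sum]
  exact Finset.sum_congr rfl fun m _ => mul_assoc _ _ _

/-- The Hermitian dual of a convolutional code `V`: the polynomial vectors all of whose shifts
`D ^ l u` are orthogonal to `V` for the Hermitian inner product. (`V` is stable under
multiplication by `D`, so this is orthogonality to all shifts of the words of `V`, in both
directions of time, and it is the largest `F[D]`-submodule of the set of vectors orthogonal to
`V`.) -/
noncomputable def hermitianDual (q : ℕ) (V : Submodule F[X] (Fin n → F[X])) :
    Submodule F[X] (Fin n → F[X]) where
  carrier := {u | ∀ l : ℕ, ∀ v ∈ V, hermitianInner q ((X ^ l : F[X]) • u) v = 0}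
  add_mem' := by
    intro u u' hu hu' l v hv
    rw [smul_add, hermitianInner_add, hu l v hv, hu' l v hv, add_zero]
  zero_mem' := by
    intro l v _
    simp [hermitianInner]
  smul_mem' := by
    intro f u hu
    induction f using Polynomial.induction_on' with
    | add f g hf hg =>
      intro l v hv
      rw [add_smul, smul_add, hermitianInner_add, hf l v hv, hg l v hv, add_zero]
    | monomial m a =>
      intro l v hv
      have h : (X ^ l : F[X]) • (monomial m a • u) = (C a : F[X]) • ((X ^ (l + m) : F[X]) • u) := by
        rw [smul_smul, smul_smul, ← C_mul_X_pow_eq_monomial]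
        congr 1
        ring
      rw [h, hermitianInner_C_smul, hu _ v hv, mul_zero]

/-- Add zero rows at the bottom of `H` so as to have `κ` rows in total. -/
def padRows {r : ℕ} (κ : ℕ) (H : Matrix (Fin r) (Fin n) F) : Matrix (Fin κ) (Fin n) F :=
  fun a j => if h : (a : ℕ) < r then H ⟨a, h⟩ j else 0

/-- The matrix `A + B' D` of Piret's unit-memory construction, where `B'` is obtained from `B` by
adding zero rows at the bottom. -/
noncomputable def piretMatrix {κ r : ℕ} (A : Matrix (Fin κ) (Fin n) F)
    (B : Matrix (Fin r) (Fin n) F) : Matrix (Fin κ) (Fin n) F[X] :=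
  A.map C + (X : F[X]) • (padRows κ B).map C

end Conv

end ConvCode

/-! Put `Q = q ^ 2`, `b = β ^ s`, `ζ = β ^ 2`. Then `n = Q + 1` gives `ζ ^ Q = ζ⁻¹`, and `q ≡ 1 (mod
4)` gives `b ^ Q = b`. So Frobenius over `F` exchanges `b ζ ^ t` and `b ζ ^ (-t)`: the zeros with `0
≤ t ≤ r` bring along those with `-r ≤ t < 0`, and the BCH bound for these `2r + 1` consecutive zeros
gives distance at least `2r + 2` (`eq_zero_of_conjugate_zeros`).

The zero `b` costs one dimension and every other at most two, so the codimensions of `C₁` and `C₀`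
are at most `2i - 1` and `2`. The Singleton bound forces codimension at least `2i + 1` on `C₂ = C₁ ∩
C₀`; hence all are equalities (`finrank_codeOfZeros`) and the stacked parity checks have full rank.

Full rank of the stack makes Piret's matrix basic and reduced. Up to conjugation by `x ↦ x ^ q`, the
Hermitian dual is the kernel of the reversed matrix `A D + B'`; completing the stack to an
invertible matrix shows that this kernel is generated by another Piret matrix
(`exists_generated_eq_kernel`), whence degree `2` and memory `1`.

For a word of the dual, the conjugated lowest coefficient vector lies in `C₀` and the highest in
`C₁`. If they are distinct the weight is at least `2 + 2i`; if they coincide, they lie in `C₂`, of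
distance at least `2i + 2`. A minimal word of `C₂`, read as a constant, attains the bound. -/

namespace ConvCode

/-! ### Linear algebra: full-rank matrices and their completions. -/

section Matrices

variable {F : Type*} [Field F]

theorem linearIndependent_row_of_mul_eq_one {R : Type*} [CommRing R] {ι ν : Type*} [Fintype ι]
    [DecidableEq ι] [Fintype ν] {S : Matrix ι ν R} {T : Matrix ν ι R} (h : S * T = 1) :
    LinearIndependent R S.row := by
  rw [← Matrix.vecMul_injective_iff]
  intro u v huv
  have := congrArg (fun w => Matrix.vecMul w T) huv
  simpa [Matrix.vecMul_vecMul, h] using this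

/-- A matrix with linearly independent rows can be completed to an invertible matrix. -/
theorem exists_completion {ι : Type*} [Fintype ι] [DecidableEq ι] {n m : ℕ}
    (S : Matrix ι (Fin n) F) (hS : LinearIndependent F S.row) (hm : Fintype.card ι + m = n) :
    ∃ (E : Matrix (Fin m) (Fin n) F) (P : Matrix (Fin n) (ι ⊕ Fin m) F),
      Matrix.fromRows S E * P = 1 ∧ P * Matrix.fromRows S E = 1 := by
  classical
  let b := Module.Basis.sumExtend hS
  have : Fintype (ι ⊕ Module.Basis.sumExtendIndex hS) := FiniteDimensional.fintypeBasisIndex b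
  have : Finite (Module.Basis.sumExtendIndex hS) :=
    Finite.of_injective (Sum.inr : _ → ι ⊕ Module.Basis.sumExtendIndex hS) Sum.inr_injective
  have : Fintype (Module.Basis.sumExtendIndex hS) := Fintype.ofFinite _
  have hc : Fintype.card (Module.Basis.sumExtendIndex hS) = m := by
    have h1 := Module.finrank_eq_card_basis b
    rw [Module.finrank_fin_fun, ← Nat.card_eq_fintype_card, Nat.card_sum,
      Nat.card_eq_fintype_card, Nat.card_eq_fintype_card] at h1
    omega
  let e : Module.Basis.sumExtendIndex hS ≃ Fin m := Fintype.equivFinOfCardEq hc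
  let b' := b.reindex (Equiv.sumCongr (Equiv.refl ι) e)
  let p := Pi.basisFun F (Fin n)
  -- The rows of the completed matrix form a basis, so it is a transposed change-of-basis matrix and
  -- the opposite change of basis inverts it.
  have key : Matrix.fromRows S (Matrix.of fun j => b' (Sum.inr j)) = (p.toMatrix b').transpose := by
    ext x j
    rcases x with a | a
    · have : b (Sum.inl a) = S a := by
        simp [b, Module.Basis.sumExtend]
        rfl
      simp [p, Module.Basis.toMatrix_apply, b', this]
    · simp [p, Module.Basis.toMatrix_apply]
  refine ⟨Matrix.of fun j => b' (Sum.inr j), (b'.toMatrix p).transpose, ?_, ?_⟩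
  · rw [key, ← Matrix.transpose_mul, Module.Basis.toMatrix_mul_toMatrix_flip, Matrix.transpose_one]
  · rw [key, ← Matrix.transpose_mul, Module.Basis.toMatrix_mul_toMatrix_flip, Matrix.transpose_one]

theorem exists_right_inverse {ι : Type*} [Fintype ι] [DecidableEq ι] {n : ℕ}
    (S : Matrix ι (Fin n) F) (hS : LinearIndependent F S.row) :
    ∃ R : Matrix (Fin n) ι F, S * R = 1 := by
  have hle : Fintype.card ι ≤ n := by
    simpa using hS.fintype_card_le_finrank
  obtain ⟨E, P, h, -⟩ := exists_completion S hS (Nat.add_sub_cancel' hle)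
  refine ⟨P.toCols₁, ?_⟩
  ext a b
  have := congrFun (congrFun h (Sum.inl a)) (Sum.inl b)
  simpa [Matrix.mul_apply, Matrix.one_apply] using this

end Matrices

/-! ### Piret matrices: basic, reduced, degree and memory. -/

section Piret

variable {F : Type*} [Field F] {κ n : ℕ}

/-- The matrix of the inclusion of the first `r` coordinates. -/
def headIncl (R : Type*) [Zero R] [One R] (κ r : ℕ) : Matrix (Fin κ) (Fin r) R :=
  fun a b => if (a : ℕ) = b then 1 else 0

theorem headIncl_map {R S : Type*} [Semiring R] [Semiring S] (f : R →+* S) (κ r : ℕ) :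
    (headIncl R κ r).map f = headIncl S κ r := by
  ext a b
  simp only [headIncl, Matrix.map_apply]
  split_ifs <;> simp

theorem padRows_eq {r : ℕ} (κ : ℕ) (B : Matrix (Fin r) (Fin n) F) :
    padRows κ B = headIncl F κ r * B := by
  ext a j
  simp only [padRows, headIncl, Matrix.mul_apply, ite_mul, one_mul, zero_mul]
  split_ifs with h
  · rw [Finset.sum_eq_single ⟨a, h⟩]
    · simp
    · intro b _ hb
      rw [if_neg]
      intro h'
      exact hb (Fin.ext h'.symm)
    · simp
  · symm
    apply Finset.sum_eq_zero
    intro b _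
    rw [if_neg]
    have := b.2
    omega

theorem vecMul_headIncl {R : Type*} [CommRing R] {r : ℕ} (h : r ≤ κ) (u : Fin κ → R)
    (b : Fin r) : Matrix.vecMul u (headIncl R κ r) b = u (Fin.castLE h b) := by
  simp only [Matrix.vecMul, dotProduct, headIncl, mul_ite, mul_one, mul_zero]
  rw [Finset.sum_eq_single (Fin.castLE h b)]
  · simp
  · intro a _ ha
    rw [if_neg]
    intro h'
    exact ha (Fin.ext (by simpa using h'))
  · simp

/-- Separates the dependence on `D` from the constant stack of `A` and `B`: a right inverse of the
stack reduces questions about the code to the explicit left factor. -/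
theorem piretMatrix_eq {r : ℕ} (A : Matrix (Fin κ) (Fin n) F) (B : Matrix (Fin r) (Fin n) F) :
    piretMatrix A B = Matrix.fromCols (1 : Matrix (Fin κ) (Fin κ) F[X])
      ((X : F[X]) • headIncl F[X] κ r) * (Matrix.fromRows A B).map C := by
  rw [Matrix.fromRows_map, Matrix.fromCols_mul_fromRows, Matrix.one_mul, piretMatrix, padRows_eq,
    Matrix.map_mul, headIncl_map, Matrix.smul_mul]

theorem natDegree_piretMatrix_le {r : ℕ} (A : Matrix (Fin κ) (Fin n) F)
    (B : Matrix (Fin r) (Fin n) F) (a : Fin κ) (j : Fin n) :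
    (piretMatrix A B a j).natDegree ≤ 1 := by
  have : piretMatrix A B a j = C (padRows κ B a j) * X + C (A a j) := by
    simp [piretMatrix]; ring
  rw [this]
  exact natDegree_linear_le

theorem constraintLength_piretMatrix_of_lt {r : ℕ} (A : Matrix (Fin κ) (Fin n) F)
    (B : Matrix (Fin r) (Fin n) F) (hB : LinearIndependent F B.row) (a : Fin κ)
    (ha : (a : ℕ) < r) : constraintLength (piretMatrix A B) a = 1 := by
  apply le_antisymm
  · exact Finset.sup_le fun j _ => natDegree_piretMatrix_le A B a j
  · obtain ⟨j, hj⟩ : ∃ j, B ⟨a, ha⟩ j ≠ 0 := by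
      by_contra! h
      exact hB.ne_zero ⟨a, ha⟩ (show B.row ⟨a, ha⟩ = 0 from _root_.funext h)
    have h2 : (piretMatrix A B a j).natDegree = 1 := by
      have : piretMatrix A B a j = C (B ⟨a, ha⟩ j) * X + C (A a j) := by
        simp [piretMatrix, padRows, ha]; ring
      rw [this]
      exact natDegree_linear hj
    rw [← h2]
    exact Finset.le_sup (f := fun j => (piretMatrix A B a j).natDegree) (Finset.mem_univ j)

theorem constraintLength_piretMatrix_of_le {r : ℕ} (A : Matrix (Fin κ) (Fin n) F)
    (B : Matrix (Fin r) (Fin n) F) (a : Fin κ) (ha : r ≤ (a : ℕ)) :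
    constraintLength (piretMatrix A B) a = 0 := by
  refine Nat.le_zero.1 (Finset.sup_le fun j _ => ?_)
  have : piretMatrix A B a j = C (A a j) := by
    simp [piretMatrix, padRows, not_lt.2 ha]
  rw [this, natDegree_C]

theorem overallConstraintLength_piretMatrix {r : ℕ} (hr : r ≤ κ) (A : Matrix (Fin κ) (Fin n) F)
    (B : Matrix (Fin r) (Fin n) F) (hB : LinearIndependent F B.row) :
    overallConstraintLength (piretMatrix A B) = r := by
  obtain ⟨m, rfl⟩ := Nat.exists_eq_add_of_le hr
  rw [overallConstraintLength, Fin.sum_univ_add]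
  rw [Finset.sum_congr rfl fun a _ => constraintLength_piretMatrix_of_lt A B hB _ (by simp),
    Finset.sum_congr rfl fun a _ => constraintLength_piretMatrix_of_le A B _ (by simp)]
  simp

theorem memory_piretMatrix {r : ℕ} (hr : r ≤ κ) (hr0 : 0 < r) (A : Matrix (Fin κ) (Fin n) F)
    (B : Matrix (Fin r) (Fin n) F) (hB : LinearIndependent F B.row) :
    memory (piretMatrix A B) = 1 := by
  apply le_antisymm
  · exact Finset.sup_le fun a _ => Finset.sup_le fun j _ => natDegree_piretMatrix_le A B a j
  · rw [← constraintLength_piretMatrix_of_lt A B hB ⟨0, hr0.trans_le hr⟩ hr0]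
    exact Finset.le_sup (Finset.mem_univ _)

/-- A constant word of the code generated by `piretMatrix A B` is a combination of the rows of `A`
with index at least `r`. -/
theorem constant_mem_generated_piretMatrix {r : ℕ} (hr : r ≤ κ) {A : Matrix (Fin κ) (Fin n) F}
    {B : Matrix (Fin r) (Fin n) F} {R : Matrix (Fin n) (Fin κ ⊕ Fin r) F}
    (hR : Matrix.fromRows A B * R = 1) {g : Fin n → F}
    (hg : (fun j => C (g j)) ∈ generated (piretMatrix A B)) :
    ∃ w : {a : Fin κ // r ≤ (a : ℕ)} → F, ∑ a, w a • A a = g := by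
  obtain ⟨u, hu⟩ := hg
  have hu' : Matrix.vecMul u (piretMatrix A B) = fun j => C (g j) := hu
  have hG : piretMatrix A B * R.map C = Matrix.fromCols (1 : Matrix (Fin κ) (Fin κ) F[X])
      ((X : F[X]) • headIncl F[X] κ r) := by
    rw [piretMatrix_eq, Matrix.mul_assoc, ← Matrix.map_mul, hR]
    simp
  have h1 : Matrix.vecMul u (Matrix.fromCols (1 : Matrix (Fin κ) (Fin κ) F[X])
      ((X : F[X]) • headIncl F[X] κ r)) = fun x => C (Matrix.vecMul g R x) := by
    rw [← hG, ← Matrix.vecMul_vecMul, hu']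
    funext x
    exact (RingHom.map_vecMul C R g x).symm
  rw [Matrix.vecMul_fromCols] at h1
  have hc : ∀ a, u a = C (Matrix.vecMul g R (Sum.inl a)) := by
    intro a
    simpa using congrFun h1 (Sum.inl a)
  have hz : ∀ b : Fin r, u (Fin.castLE hr b) = 0 := by
    intro b
    have h2 := congrFun h1 (Sum.inr b)
    rw [Sum.elim_inr, Matrix.vecMul_smul, Pi.smul_apply, vecMul_headIncl hr, smul_eq_mul, hc] at h2
    rw [hc]
    -- `h2` equates `X` times a constant with a constant, so the former constant vanishes.
    have h3 := congrArg (fun p => coeff p 1) h2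
    simpa [coeff_X_mul, coeff_C] using h3
  refine ⟨fun a => Matrix.vecMul g R (Sum.inl a.1), ?_⟩
  funext j
  apply C_injective
  have h4 : (∑ a, u a * piretMatrix A B a j) = C (g j) := congrFun hu' j
  rw [← h4, Finset.sum_apply, map_sum,
    ← Fintype.sum_subtype_add_sum_subtype (fun a : Fin κ => r ≤ (a : ℕ))]
  have h5 : ∑ a : {a : Fin κ // ¬ r ≤ (a : ℕ)}, u a * piretMatrix A B a j = 0 := by
    refine Finset.sum_eq_zero fun a _ => ?_
    have h6 : u a = 0 := hz ⟨(a : ℕ), not_le.1 a.2⟩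
    rw [h6, zero_mul]
  rw [h5, add_zero]
  refine Finset.sum_congr rfl fun a _ => ?_
  rw [hc]
  simp [piretMatrix, padRows, not_lt.2 a.2]

/-- Every basic generator matrix of the code of `piretMatrix A B` has at least `r` nonconstant
rows. -/
theorem le_overallConstraintLength {r : ℕ} (hr : r ≤ κ) {A : Matrix (Fin κ) (Fin n) F}
    {B : Matrix (Fin r) (Fin n) F} (hAB : LinearIndependent F (Matrix.fromRows A B).row)
    {G' : Matrix (Fin κ) (Fin n) F[X]} (hG' : IsBasic G')
    (hgen : generated G' = generated (piretMatrix A B)) :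
    r ≤ overallConstraintLength G' := by
  classical
  obtain ⟨R, hR⟩ := exists_right_inverse _ hAB
  obtain ⟨R', hR'⟩ := hG'
  let S := {a : Fin κ // constraintLength G' a = 0}
  let g : S → Fin n → F := fun a j => (G' a j).coeff 0
  have hgC : ∀ a : S, (fun j => C (g a j)) = G' a := by
    intro a
    funext j
    have h1 : (G' a j).natDegree = 0 := by
      have := Finset.le_sup (f := fun j => (G' a j).natDegree) (Finset.mem_univ j)
      exact Nat.le_zero.1 (this.trans (le_of_eq a.2))
    exact (eq_C_of_natDegree_eq_zero h1).symm
  have hw : ∀ a : S, ∃ w : {a : Fin κ // r ≤ (a : ℕ)} → F, ∑ b, w b • A b = g a := by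
    intro a
    refine constant_mem_generated_piretMatrix hr hR ?_
    rw [hgC, ← hgen]
    refine ⟨Pi.single a.1 1, ?_⟩
    simp
    rfl
  choose w hw using hw
  have hli : LinearIndependent F g := by
    let f : (Fin n → F) →ₗ[F] (Fin n → F[X]) :=
      LinearMap.compLeft (Algebra.linearMap F F[X]) (Fin n)
    apply LinearIndependent.of_comp f
    have h1 : LinearIndependent F G'.row := by
      apply (linearIndependent_row_of_mul_eq_one hR').restrict_scalars
      intro x y hxy
      simpa [smul_eq_C_mul] using hxy
    have h2 := h1.comp (fun a : S => a.1) Subtype.val_injective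
    convert h2 using 1
    funext a
    exact hgC a
  -- The constant rows of `G'` are independent and lie in the span of the last `κ - r` rows of `A`,
  -- so there are at most `κ - r` of them; each remaining row contributes at least one to the
  -- degree.
  have hliw : LinearIndependent F w := by
    apply LinearIndependent.of_comp
      (Fintype.linearCombination F (fun b : {a : Fin κ // r ≤ (a : ℕ)} => A b))
    convert hli using 1
    funext a
    rw [← hw a]
    rfl
  have hcard := hliw.fintype_card_le_finrank
  rw [Module.finrank_fintype_fun_eq_card] at hcard
  have hc2 : Fintype.card {a : Fin κ // r ≤ (a : ℕ)} + r = κ := by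
    obtain ⟨m, rfl⟩ := Nat.exists_eq_add_of_le hr
    rw [Fintype.card_subtype, Finset.card_filter, Fin.sum_univ_add,
      Finset.sum_congr rfl fun a _ => if_neg (by simp),
      Finset.sum_congr rfl fun a _ => if_pos (by simp)]
    simp [add_comm]
  have hc3 : κ ≤ Fintype.card S + overallConstraintLength G' := by
    rw [Fintype.card_subtype, Finset.card_filter, overallConstraintLength, ← Finset.sum_add_distrib]
    calc κ = ∑ a : Fin κ, 1 := by simp
      _ ≤ _ := Finset.sum_le_sum fun a _ => by split_ifs <;> omega
  omega

theorem isBasic_piretMatrix {r : ℕ} {A : Matrix (Fin κ) (Fin n) F}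
    {B : Matrix (Fin r) (Fin n) F} (hAB : LinearIndependent F (Matrix.fromRows A B).row) :
    IsBasic (piretMatrix A B) := by
  obtain ⟨R, hR⟩ := exists_right_inverse _ hAB
  refine ⟨R.toCols₁.map C, ?_⟩
  have h : Matrix.fromRows A B * R.toCols₁ = Matrix.fromRows 1 0 := by
    ext x b
    have := congrFun (congrFun hR x) (Sum.inl b)
    rcases x with a | a <;> simpa [Matrix.mul_apply, Matrix.one_apply] using this
  rw [piretMatrix_eq, Matrix.mul_assoc, ← Matrix.map_mul, h, Matrix.fromRows_map,
    Matrix.fromCols_mul_fromRows]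
  simp

theorem isGeneratorWith_piretMatrix {r : ℕ} (hr : r ≤ κ) (hr0 : 0 < r)
    {A : Matrix (Fin κ) (Fin n) F} {B : Matrix (Fin r) (Fin n) F}
    (hAB : LinearIndependent F (Matrix.fromRows A B).row) :
    IsGeneratorWith (piretMatrix A B) (generated (piretMatrix A B)) r 1 := by
  have hB : LinearIndependent F B.row := hAB.comp Sum.inr Sum.inr_injective
  refine ⟨⟨isBasic_piretMatrix hAB, fun G' hG' hgen => ?_⟩, rfl,
    overallConstraintLength_piretMatrix hr A B hB, memory_piretMatrix hr hr0 A B hB⟩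
  rw [overallConstraintLength_piretMatrix hr A B hB]
  exact le_overallConstraintLength hr hAB hG' hgen

end Piret

/-! ### The Hermitian dual as the kernel of the conjugated reversed matrix. -/

section HermitianDual

variable {F : Type*} [Field F] {κ n : ℕ}

theorem hermitianInner_add_right {q : ℕ} {σ : F →+* F} (hσ : ∀ x, σ x = x ^ q)
    (w v v' : Fin n → F[X]) :
    hermitianInner q w (v + v') = hermitianInner q w v + hermitianInner q w v' := by
  unfold hermitianInner
  simp only [← hσ, Polynomial.sum_def, ← Finset.sum_add_distrib, Pi.add_apply, coeff_add, map_add,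
    mul_add]

theorem hermitianInner_sum_right {q : ℕ} {σ : F →+* F} (hσ : ∀ x, σ x = x ^ q) {ι : Type*}
    (s : Finset ι) (w : Fin n → F[X]) (v : ι → Fin n → F[X]) :
    hermitianInner q w (∑ a ∈ s, v a) = ∑ a ∈ s, hermitianInner q w (v a) :=
  map_sum (AddMonoidHom.mk' (hermitianInner q w) (hermitianInner_add_right hσ w)) v s

/-- Pairing with `D ^ m (x + D y)` sees only `w_m` and `w_(m+1)`; multiplying by the reversed row `D
x + y` collects both in degree `m + 1`. -/
theorem hermitianInner_monomial_smul {q : ℕ} {σ : F →+* F} (hσ : ∀ x, σ x = x ^ q)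
    (w : Fin n → F[X]) (x y : Fin n → F) (m : ℕ) (c : F) :
    hermitianInner q w (monomial m c • fun j => C (x j) + X * C (y j)) =
      σ c * (∑ j, (X * C (σ (x j)) + C (σ (y j))) * w j).coeff (m + 1) := by
  unfold hermitianInner
  rw [finsetSum_coeff, Finset.mul_sum]
  refine Finset.sum_congr rfl fun j _ => ?_
  have h1 : ∀ k, ((monomial m c • fun j => C (x j) + X * C (y j)) j).coeff k =
      (if m = k then c * x j else 0) + (if m + 1 = k then c * y j else 0) := by
    intro k
    rw [Pi.smul_apply, smul_eq_mul, mul_add, monomial_mul_C, mul_comm X, C_mul_X_eq_monomial,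
      monomial_mul_monomial, coeff_add, coeff_monomial, coeff_monomial]
  simp only [h1, ← hσ, map_add, apply_ite σ, map_zero, map_mul, Polynomial.sum_def, mul_add,
    Finset.sum_add_distrib, mul_ite, mul_zero, Finset.sum_ite_eq]
  have h2 : ((X * C (σ (x j)) + C (σ (y j))) * w j).coeff (m + 1) =
      σ (x j) * (w j).coeff m + σ (y j) * (w j).coeff (m + 1) := by
    rw [add_mul, mul_assoc, coeff_add, coeff_X_mul, coeff_C_mul, coeff_C_mul]
  rw [h2]
  have h3 : ∀ (k : ℕ) (z : F), (if k ∈ (w j).support then (w j).coeff k * z else 0) =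
      (w j).coeff k * z := by
    intro k z
    by_cases h : (w j).coeff k = 0 <;> simp [h]
  simp only [h3]
  ring

theorem piretMatrix_row {r : ℕ} (A : Matrix (Fin κ) (Fin n) F) (B : Matrix (Fin r) (Fin n) F)
    (a : Fin κ) :
    piretMatrix A B a = fun j => C (A a j) + X * C (padRows κ B a j) := by
  funext j
  simp [piretMatrix]

theorem mem_hermitianDual_generated_piretMatrix {q r : ℕ} {σ : F →+* F} (hσ : ∀ x, σ x = x ^ q)
    (A : Matrix (Fin κ) (Fin n) F) (B : Matrix (Fin r) (Fin n) F) (u : Fin n → F[X]) :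
    u ∈ hermitianDual q (generated (piretMatrix A B)) ↔
      ∀ a, ∑ j, (X * C (σ (A a j)) + C (σ (padRows κ B a j))) * u j = 0 := by
  have hX : ∀ l a, ∑ j, (X * C (σ (A a j)) + C (σ (padRows κ B a j))) *
      ((X ^ l : F[X]) • u) j =
      X ^ l * ∑ j, (X * C (σ (A a j)) + C (σ (padRows κ B a j))) * u j := by
    intro l a
    rw [Finset.mul_sum]
    refine Finset.sum_congr rfl fun j _ => ?_
    rw [Pi.smul_apply, smul_eq_mul]
    ring
  constructor
  · intro hu a
    ext m
    have hmem : (monomial m (1 : F) • piretMatrix A B a) ∈ generated (piretMatrix A B) := by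
      apply Submodule.smul_mem
      refine ⟨Pi.single a 1, ?_⟩
      simp
      rfl
    -- Pairings only read coefficients of index `m + 1`; one shift by `D` also brings the constant
    -- coefficient within reach.
    have h1 := hu 1 _ hmem
    rw [piretMatrix_row, hermitianInner_monomial_smul hσ, hX, map_one, one_mul, pow_one,
      coeff_X_mul] at h1
    rw [h1, coeff_zero]
  · intro hu l v hv
    obtain ⟨p, rfl⟩ := hv
    have h1 : (piretMatrix A B).vecMulLinear p = ∑ a, p a • piretMatrix A B a := by
      funext j
      simp [Matrix.vecMul, dotProduct]
    rw [h1, hermitianInner_sum_right hσ]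
    refine Finset.sum_eq_zero fun a _ => ?_
    induction p a using Polynomial.induction_on' with
    | add f g hf hg => rw [add_smul, hermitianInner_add_right hσ, hf, hg, add_zero]
    | monomial m c =>
      rw [piretMatrix_row, hermitianInner_monomial_smul hσ, hX, hu, mul_zero, coeff_zero, mul_zero]

end HermitianDual

/-! ### The kernel of a reversed Piret matrix. -/

section Kernel

variable {F : Type*} [Field F] {κ n : ℕ}

/-- The product of the reversed matrix `A X + B'`, with `B'` the padding of `B`, by `u`. -/
theorem sum_reversed_eq {r : ℕ} (A : Matrix (Fin κ) (Fin n) F) (B : Matrix (Fin r) (Fin n) F)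
    (u : Fin n → F[X]) :
    (fun a => ∑ j, (X * C (A a j) + C (padRows κ B a j)) * u j) =
      (X : F[X]) • (A.map C).mulVec u + (headIncl F[X] κ r).mulVec ((B.map C).mulVec u) := by
  rw [Matrix.mulVec_mulVec, ← headIncl_map C, ← Matrix.map_mul, ← padRows_eq]
  funext a
  simp [Matrix.mulVec, dotProduct, Finset.mul_sum, ← Finset.sum_add_distrib]
  refine Finset.sum_congr rfl fun j _ => ?_
  ring

theorem headIncl_mulVec {R : Type*} [CommRing R] {r m : ℕ} (v : Fin r → R) (a : Fin (r + m)) :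
    (headIncl R (r + m) r).mulVec v a = Fin.append v (0 : Fin m → R) a := by
  simp only [Matrix.mulVec, dotProduct, headIncl, ite_mul, one_mul, zero_mul]
  induction a using Fin.addCases with
  | left b =>
    rw [Fin.append_left, Finset.sum_eq_single b]
    · simp
    · intro c _ hc
      rw [if_neg]
      intro h
      exact hc (Fin.ext (by simpa using h.symm))
    · simp
  | right b =>
    rw [Fin.append_right]
    refine Finset.sum_eq_zero fun c _ => ?_
    rw [if_neg]
    have := c.2
    simp
    omega

/-- The kernel of `A X + B'` is again generated by a matrix of Piret type. -/
theorem exists_generated_eq_kernel {r k m : ℕ} (A : Matrix (Fin (r + k)) (Fin n) F)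
    (B : Matrix (Fin r) (Fin n) F) (hAB : LinearIndependent F (Matrix.fromRows A B).row)
    (hm : r + k + r + m = n) :
    ∃ (A' : Matrix (Fin (r + m)) (Fin n) F) (B' : Matrix (Fin r) (Fin n) F),
      LinearIndependent F (Matrix.fromRows A' B').row ∧
      ∀ u : Fin n → F[X], u ∈ generated (piretMatrix A' B') ↔
        ∀ a, ∑ j, (X * C (A a j) + C (padRows (r + k) B a j)) * u j = 0 := by
  obtain ⟨E, P, hP, hP'⟩ := exists_completion _ hAB (m := m) (by simpa using hm)
  -- In the coordinates `(y_A, y_B, y_E)` given by the completed matrix, the kernel equations kill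
  -- the last `k` entries of `y_A` and set `y_B` to `-X` times its first `r` entries; `y_E` is free.
  -- `A'` and `B'` are the matching columns of `P`, the sign being absorbed in `B'`.
  let A' : Matrix (Fin (r + m)) (Fin n) F := Matrix.of
    (Fin.append (fun b j => P j (Sum.inl (Sum.inl (Fin.castAdd k b)))) (fun c j => P j (Sum.inr c)))
  let B' : Matrix (Fin r) (Fin n) F := Matrix.of fun b j => - P j (Sum.inl (Sum.inr b))
  have hPli : LinearIndependent F P.transpose.row := by
    apply linearIndependent_row_of_mul_eq_one
      (T := (Matrix.fromRows (Matrix.fromRows A B) E).transpose)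
    rw [← Matrix.transpose_mul, hP, Matrix.transpose_one]
  refine ⟨A', B', ?_, ?_⟩
  · let f : Fin (r + m) ⊕ Fin r → (Fin (r + k) ⊕ Fin r) ⊕ Fin m :=
      Sum.elim (Fin.append (fun b => Sum.inl (Sum.inl (Fin.castAdd k b))) (fun c => Sum.inr c))
        (fun b => Sum.inl (Sum.inr b))
    have hf : Function.Injective f := by
      rintro (a | a) (b | b) hab
      · induction a using Fin.addCases <;> induction b using Fin.addCases <;>
          simp [f] at hab ⊢ <;> exact hab
      · induction a using Fin.addCases <;> simp [f] at hab
      · induction b using Fin.addCases <;> simp [f] at hab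
      · simpa [f] using hab
    have h1 := (hPli.comp f hf).units_smul (Sum.elim (fun _ => 1) (fun _ => -1))
    convert h1 using 1
    funext x j
    rcases x with a | b
    · induction a using Fin.addCases <;> simp [f, A']
    · simp [f, B']
  · let Y : (Fin (r + m) → F[X]) → (Fin (r + k) ⊕ Fin r) ⊕ Fin m → F[X] := fun z =>
      Sum.elim (Sum.elim (Fin.append (fun b => z (Fin.castAdd m b)) 0)
        (fun b => -(X * z (Fin.castAdd m b)))) (fun c => z (Fin.natAdd r c))
    have hY : ∀ z, Matrix.vecMul z (piretMatrix A' B') = (P.map C).mulVec (Y z) := by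
      intro z
      funext j
      have hA : ∀ b : Fin r, piretMatrix A' B' (Fin.castAdd m b) j =
          C (P j (Sum.inl (Sum.inl (Fin.castAdd k b)))) - X * C (P j (Sum.inl (Sum.inr b))) := by
        intro b
        simp [piretMatrix_row, A', B', padRows, sub_eq_add_neg]
      have hC : ∀ c : Fin m, piretMatrix A' B' (Fin.natAdd r c) j = C (P j (Sum.inr c)) := by
        intro c
        simp [piretMatrix_row, A', padRows]
      simp only [Matrix.vecMul, Matrix.mulVec, dotProduct, Fintype.sum_sum_type, Fin.sum_univ_add,
        hA, hC, Matrix.map_apply, Y, Sum.elim_inl, Sum.elim_inr, Fin.append_left,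
        Fin.append_right, Pi.zero_apply, mul_zero, Finset.sum_const_zero, add_zero]
      rw [← Finset.sum_add_distrib]
      congr 1
      · exact Finset.sum_congr rfl fun b _ => by ring
      · exact Finset.sum_congr rfl fun c _ => by ring
    let M := Matrix.fromRows (Matrix.fromRows A B) E
    have hMP : M.map C * P.map C = (1 : Matrix _ _ F[X]) := by
      rw [← Matrix.map_mul, hP]
      simp
    have hPM : P.map C * M.map C = (1 : Matrix _ _ F[X]) := by
      rw [← Matrix.map_mul, hP']
      simp
    have hker : ∀ u : Fin n → F[X],
        (∀ a, ∑ j, (X * C (A a j) + C (padRows (r + k) B a j)) * u j = 0) ↔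
        ∃ z, (M.map C).mulVec u = Y z := by
      intro u
      have hM : (M.map C).mulVec u = Sum.elim (Sum.elim ((A.map C).mulVec u) ((B.map C).mulVec u))
          ((E.map C).mulVec u) := by
        simp only [M, Matrix.fromRows_map, Matrix.fromRows_mulVec]
      have h1 : (∀ a, ∑ j, (X * C (A a j) + C (padRows (r + k) B a j)) * u j = 0) ↔
          ∀ a, ((X : F[X]) • (A.map C).mulVec u +
            (headIncl F[X] (r + k) r).mulVec ((B.map C).mulVec u)) a = 0 := by
        rw [← sum_reversed_eq]
      rw [h1, hM]
      simp only [Pi.add_apply, Pi.smul_apply, smul_eq_mul, headIncl_mulVec]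
      constructor
      · intro h
        refine ⟨Fin.append (fun b => (A.map C).mulVec u (Fin.castAdd k b)) ((E.map C).mulVec u), ?_⟩
        funext x
        rcases x with (a | b) | c
        · induction a using Fin.addCases with
          | left b => simp [Y]
          | right c =>
            have h2 := h (Fin.natAdd r c)
            rw [Fin.append_right, Pi.zero_apply, add_zero] at h2
            simpa [Y] using h2
        · have h2 := h (Fin.castAdd k b)
          rw [Fin.append_left] at h2
          simp only [Y, Sum.elim_inl, Sum.elim_inr, Fin.append_left]
          linear_combination h2
        · simp [Y]
      · rintro ⟨z, hz⟩ a
        have hA : (A.map C).mulVec u = _ := funext fun a => congrFun hz (Sum.inl (Sum.inl a))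
        have hB : (B.map C).mulVec u = _ := funext fun b => congrFun hz (Sum.inl (Sum.inr b))
        rw [hA, hB]
        induction a using Fin.addCases <;> simp [Y]
    intro u
    rw [hker]
    constructor
    · rintro ⟨z, hz⟩
      refine ⟨z, ?_⟩
      have hz' : Matrix.vecMul z (piretMatrix A' B') = u := hz
      rw [← hz', hY, Matrix.mulVec_mulVec, hMP, Matrix.one_mulVec]
    · rintro ⟨z, hz⟩
      refine ⟨z, ?_⟩
      change Matrix.vecMul z (piretMatrix A' B') = u
      rw [hY, ← hz, Matrix.mulVec_mulVec, hPM, Matrix.one_mulVec]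

end Kernel

/-! ### Parity check matrices and the Singleton bound. -/

section ParityCheck

variable {F : Type*} [Field F] {n : ℕ}

theorem linearIndependent_row_of_finrank_ker {ι : Type*} [Fintype ι] [DecidableEq ι]
    (S : Matrix ι (Fin n) F)
    (h : Module.finrank F (LinearMap.ker S.mulVecLin) + Fintype.card ι = n) :
    LinearIndependent F S.row := by
  have h1 := LinearMap.finrank_range_add_finrank_ker S.mulVecLin
  rw [Module.finrank_fin_fun] at h1
  have h2 : LinearMap.range S.mulVecLin = ⊤ := by
    apply Submodule.eq_top_of_finrank_eq
    rw [Module.finrank_fintype_fun_eq_card]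
    omega
  have h3 : Function.Surjective S.mulVec := LinearMap.range_eq_top.1 h2
  obtain ⟨T, hT⟩ := Matrix.mulVec_surjective_iff_exists_right_inverse.1 h3
  exact linearIndependent_row_of_mul_eq_one hT

theorem exists_isParityCheck {r : ℕ} (U : Submodule F (Fin n → F))
    (h : Module.finrank F U + r = n) :
    ∃ H : Matrix (Fin r) (Fin n) F, IsParityCheck H (U : Set (Fin n → F)) := by
  have h1 := Submodule.finrank_quotient_add_finrank U
  rw [Module.finrank_fin_fun] at h1
  let e : ((Fin n → F) ⧸ U) ≃ₗ[F] (Fin r → F) :=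
    LinearEquiv.ofFinrankEq _ _ (by rw [Module.finrank_fin_fun]; omega)
  let f : (Fin n → F) →ₗ[F] (Fin r → F) := e.toLinearMap ∘ₗ U.mkQ
  have hf : ∀ c, (LinearMap.toMatrix' f).mulVec c = f c := fun c => LinearMap.toMatrix'_mulVec f c
  have hker : ∀ c, c ∈ U ↔ f c = 0 := by
    intro c
    simp [f]
  refine ⟨LinearMap.toMatrix' f, ?_, fun c => ?_⟩
  · apply linearIndependent_row_of_finrank_ker
    have h2 : LinearMap.ker (LinearMap.toMatrix' f).mulVecLin = U := by
      ext c
      rw [hker, LinearMap.mem_ker, Matrix.mulVecLin_apply, hf]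
    rw [h2, Fintype.card_fin, h]
  · rw [hf, ← hker]
    rfl

theorem IsParityCheck.fromRows {r₁ r₀ : ℕ} {H₁ : Matrix (Fin r₁) (Fin n) F}
    {H₀ : Matrix (Fin r₀) (Fin n) F} {B₁ B₀ : Set (Fin n → F)} (h₁ : IsParityCheck H₁ B₁)
    (h₀ : IsParityCheck H₀ B₀) {U : Submodule F (Fin n → F)} (hU : (U : Set (Fin n → F)) = B₁ ∩ B₀)
    (h : Module.finrank F U + (r₁ + r₀) = n) :
    IsParityCheck (Matrix.fromRows H₁ H₀) (U : Set (Fin n → F)) := by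
  have hmem : ∀ c, c ∈ (U : Set (Fin n → F)) ↔ (Matrix.fromRows H₁ H₀).mulVec c = 0 := by
    intro c
    rw [hU, Set.mem_inter_iff, h₁.2, h₀.2, Matrix.fromRows_mulVec, ← Sum.elim_zero_zero,
      Sum.elim_eq_iff]
  refine ⟨linearIndependent_row_of_finrank_ker _ ?_, hmem⟩
  have h2 : LinearMap.ker (Matrix.fromRows H₁ H₀).mulVecLin = U := by
    ext c
    exact (hmem c).symm
  rw [h2, Fintype.card_sum, Fintype.card_fin, Fintype.card_fin, h]

/-- The Singleton bound. -/
theorem exists_hammingNorm_le [DecidableEq F] (U : Submodule F (Fin n → F)) {m : ℕ} (hm : m < n)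
    (hU : m + 1 ≤ Module.finrank F U) :
    ∃ c ∈ U, c ≠ 0 ∧ hammingNorm c ≤ n - m := by
  -- Restriction to the first `m` coordinates cannot be injective on a space of dimension greater
  -- than `m`.
  let f : U →ₗ[F] (Fin m → F) := (LinearMap.funLeft F F (Fin.castLE hm.le)) ∘ₗ U.subtype
  have hf : ¬ Function.Injective f := by
    intro hinj
    have := LinearMap.finrank_le_finrank_of_injective hinj
    rw [Module.finrank_fin_fun] at this
    omega
  rw [← LinearMap.ker_eq_bot, Submodule.eq_bot_iff] at hf
  push Not at hf
  obtain ⟨c, hc, hc0⟩ := hf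
  refine ⟨c, c.2, fun h => hc0 (Subtype.ext h), ?_⟩
  have h1 : ∀ j : Fin m, (c : Fin n → F) (Fin.castLE hm.le j) = 0 := fun j => congrFun hc j
  have h2 : (Finset.univ.filter fun j => (c : Fin n → F) j ≠ 0) ⊆
      Finset.univ \ (Finset.univ.map (Fin.castLEEmb hm.le)) := by
    intro j hj
    simp only [Finset.mem_sdiff, Finset.mem_univ, true_and, Finset.mem_map, not_exists]
    intro l hl
    rw [Finset.mem_filter] at hj
    exact hj.2 (hl ▸ h1 l)
  refine (Finset.card_le_card h2).trans (le_of_eq ?_)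
  rw [Finset.card_sdiff_of_subset (Finset.subset_univ _)]
  simp

end ParityCheck

/-! ### Codes defined by zeros; the BCH bound. -/

section Zeros

variable {F K : Type*} [Field F] [Field K] [Algebra F K] {n : ℕ}

theorem aeval_wordPoly (ω : K) (c : Fin n → F) :
    aeval ω (wordPoly c) = ∑ j, algebraMap F K (c j) * ω ^ (j : ℕ) := by
  simp [wordPoly]

/-- `wordPoly` as a linear map. -/
noncomputable def wordPolyHom (F : Type*) [Field F] (n : ℕ) : (Fin n → F) →ₗ[F] F[X] where
  toFun := wordPoly
  map_add' c d := by simp [wordPoly, add_mul, Finset.sum_add_distrib]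
  map_smul' a c := by simp [wordPoly, Finset.mul_sum, mul_assoc, smul_eq_C_mul]

/-- The words of length `n` over `F` whose polynomial vanishes at `ω t` for `t ∈ T`. -/
noncomputable def codeOfZeros (F : Type*) [Field F] [Algebra F K] (n : ℕ) {ι : Type*} (ω : ι → K)
    (T : Finset ι) : Submodule F (Fin n → F) :=
  ⨅ t ∈ T, LinearMap.ker ((aeval (R := F) (ω t)).toLinearMap ∘ₗ wordPolyHom F n)

theorem mem_codeOfZeros {ι : Type*} {ω : ι → K} {T : Finset ι} {c : Fin n → F} :
    c ∈ codeOfZeros F n ω T ↔ ∀ t ∈ T, aeval (ω t) (wordPoly c) = 0 := by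
  simp only [codeOfZeros, Submodule.mem_iInf, LinearMap.mem_ker]
  exact Iff.rfl

theorem codeOfZeros_insert {ι : Type*} [DecidableEq ι] (ω : ι → K) (t : ι) (T : Finset ι) :
    codeOfZeros F n ω (insert t T) = codeOfZeros F n ω T ⊓ codeOfZeros F n ω {t} := by
  ext c
  simp only [Submodule.mem_inf, mem_codeOfZeros, Finset.mem_insert, forall_eq_or_imp,
    Finset.mem_singleton, forall_eq]
  exact and_comm

theorem le_finrank_codeOfZeros [Algebra.IsIntegral F K] {ι : Type*} (ω : ι → K) (T : Finset ι) :
    n ≤ Module.finrank F (codeOfZeros F n ω T) + ∑ t ∈ T, (minpoly F (ω t)).natDegree := by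
  have hmonic : ∀ t ∈ T, (minpoly F (ω t)).Monic := fun t _ =>
    minpoly.monic (Algebra.IsIntegral.isIntegral (ω t))
  -- The product can replace the lcm, since only a lower bound on the dimension is claimed.
  let g := ∏ t ∈ T, minpoly F (ω t)
  have hg : g.Monic := monic_prod_of_monic _ _ hmonic
  have hdeg : g.natDegree = ∑ t ∈ T, (minpoly F (ω t)).natDegree :=
    natDegree_prod_of_monic _ _ hmonic
  let f := (modByMonicHom g) ∘ₗ wordPolyHom F n
  have h1 := LinearMap.finrank_range_add_finrank_ker f
  rw [Module.finrank_fin_fun] at h1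
  have h2 : LinearMap.range f ≤ degreeLT F g.natDegree := by
    rintro _ ⟨c, rfl⟩
    rw [mem_degreeLT, ← degree_eq_natDegree hg.ne_zero]
    exact degree_modByMonic_lt _ hg
  have h3 : Module.finrank F (degreeLT F g.natDegree) = g.natDegree := by
    rw [(degreeLTEquiv F g.natDegree).finrank_eq, Module.finrank_fin_fun]
  have : FiniteDimensional F (degreeLT F g.natDegree) :=
    (degreeLTEquiv F g.natDegree).symm.finiteDimensional
  have h4 := Submodule.finrank_mono h2
  have h5 : LinearMap.ker f ≤ codeOfZeros F n ω T := by
    intro c hc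
    rw [mem_codeOfZeros]
    intro t ht
    have h6 : g ∣ wordPoly c := (modByMonic_eq_zero_iff_dvd hg).1 hc
    exact (minpoly.dvd_iff).1 ((Finset.dvd_prod_of_mem _ ht).trans h6)
  have h7 := Submodule.finrank_mono h5
  omega

/-- The zeros are roots of `x ^ n + 1`, so the generator divides `x ^ n + 1` and membership modulo
`x ^ n + 1` is plain divisibility. -/
theorem mem_negacyclicBCH {β : K} {b δ : ℕ} (hβ : ∀ t < δ - 1, (β ^ (b + 2 * t)) ^ n = -1)
    {c : Fin n → F} :
    c ∈ negacyclicBCH F n β b δ ↔ ∀ t < δ - 1, aeval (β ^ (b + 2 * t)) (wordPoly c) = 0 := by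
  have hlcm : ∀ p : F[X], bchGenerator β b δ ∣ p ↔
      ∀ t < δ - 1, aeval (β ^ (b + 2 * t)) p = 0 := by
    intro p
    classical
    let _ : NormalizedGCDMonoid F[X] := UniqueFactorizationMonoid.toNormalizedGCDMonoid F[X]
    unfold bchGenerator
    refine Finset.lcm_dvd_iff.trans ?_
    simp only [Finset.mem_range, minpoly.dvd_iff]
  have hdvd : bchGenerator β b δ ∣ (X ^ n + 1 : F[X]) := by
    rw [hlcm]
    intro t ht
    simp [hβ t ht]
  rw [← hlcm]
  change Ideal.Quotient.mk _ (wordPoly c) ∈ Ideal.span _ ↔ _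
  rw [Ideal.mem_span_singleton]
  constructor
  · rintro ⟨r, hr⟩
    obtain ⟨r, rfl⟩ := Ideal.Quotient.mk_surjective r
    rw [← map_mul, Ideal.Quotient.eq, Ideal.mem_span_singleton] at hr
    exact (dvd_sub_left (dvd_mul_right _ _)).1 (hdvd.trans hr)
  · intro h
    exact map_dvd _ h

/-- The BCH bound. -/
theorem eq_zero_of_zeros [DecidableEq F] {a ζ : K} (ha : a ≠ 0) (hζ : IsPrimitiveRoot ζ n)
    {d : ℕ} {c : Fin n → F} (hc : ∀ j < d, aeval (a * ζ ^ j) (wordPoly c) = 0)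
    (hd : hammingNorm c ≤ d) : c = 0 := by
  classical
  have h1 : ∀ p : K[X], p.natDegree < d →
      ∑ m, algebraMap F K (c m) * a ^ (m : ℕ) * p.eval (ζ ^ (m : ℕ)) = 0 := by
    intro p hp
    simp_rw [eval_eq_sum_range' hp, Finset.mul_sum]
    rw [Finset.sum_comm]
    refine Finset.sum_eq_zero fun j hj => ?_
    have h2 := hc j (Finset.mem_range.1 hj)
    rw [aeval_wordPoly] at h2
    calc _ = p.coeff j * ∑ m : Fin n, algebraMap F K (c m) * (a * ζ ^ j) ^ (m : ℕ) := by
          rw [Finset.mul_sum]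
          refine Finset.sum_congr rfl fun m _ => ?_
          rw [mul_pow, ← pow_mul, ← pow_mul, mul_comm j]
          ring
      _ = 0 := by rw [h2, mul_zero]
  funext m₀
  by_contra hm₀
  let S := (Finset.univ.filter fun j => c j ≠ 0).erase m₀
  have hS : S.card < d := by
    refine lt_of_lt_of_le (Finset.card_erase_lt_of_mem ?_) hd
    simpa using hm₀
  let p : K[X] := ∏ m ∈ S, (X - C (ζ ^ (m : ℕ)))
  have hp : p.natDegree = S.card := natDegree_finsetProd_X_sub_C_eq_card _ _
  have h2 := h1 p (hp ▸ hS)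
  rw [Finset.sum_eq_single m₀] at h2
  · rw [mul_eq_zero, mul_eq_zero] at h2
    rcases h2 with (h2 | h2) | h2
    · exact hm₀ (by simpa using h2)
    · exact pow_ne_zero _ ha h2
    · rw [eval_prod, Finset.prod_eq_zero_iff] at h2
      obtain ⟨m, hm, h3⟩ := h2
      rw [eval_sub, eval_X, eval_C, sub_eq_zero] at h3
      exact (Finset.ne_of_mem_erase hm) (Fin.ext (hζ.pow_inj m.2 m₀.2 h3.symm))
  · intro m _ hm
    by_cases hcm : c m = 0
    · simp [hcm]
    · have : p.eval (ζ ^ (m : ℕ)) = 0 := by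
        rw [eval_prod]
        refine Finset.prod_eq_zero (i := m) ?_ (by simp)
        simp [S, hm, hcm]
      rw [this, mul_zero]
  · simp

end Zeros

/-! ### Free distance and parameters of the dual. -/

section FreeDistance

variable {F : Type*} [Field F] {κ n : ℕ}

theorem sum_hammingNorm_le_weight [DecidableEq F] {σ : F →+* F} (u : Fin n → F[X])
    (M : Finset ℕ) :
    ∑ m ∈ M, hammingNorm (fun j => σ ((u j).coeff m)) ≤ weight u := by
  unfold hammingNorm weight
  simp_rw [Finset.card_filter]
  rw [Finset.sum_comm]
  refine Finset.sum_le_sum fun j _ => ?_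
  rw [← Finset.card_filter]
  refine Finset.card_le_card fun m hm => ?_
  rw [Finset.mem_filter] at hm
  rw [mem_support_iff]
  intro h
  exact hm.2 (by rw [h, map_zero])

theorem map_padRows {r : ℕ} (σ : F →+* F) (B : Matrix (Fin r) (Fin n) F) (a : Fin κ) (j : Fin n) :
    padRows κ (B.map σ) a j = σ (padRows κ B a j) := by
  unfold padRows
  split_ifs <;> simp

theorem mulVec_eq_zero_of_padRows {r : ℕ} (hr : r ≤ κ) {B : Matrix (Fin r) (Fin n) F}
    {x : Fin n → F} (h : (padRows κ B).mulVec x = 0) : B.mulVec x = 0 := by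
  funext b
  have := congrFun h (Fin.castLE hr b)
  simpa [Matrix.mulVec, padRows] using this

/-- Membership in the Hermitian dual in terms of the vectors of coefficients. -/
theorem mem_hermitianDual_iff_coeff {q r : ℕ} {σ : F →+* F} (hσ : ∀ x, σ x = x ^ q)
    (hσσ : ∀ x, σ (σ x) = x) (A : Matrix (Fin κ) (Fin n) F) (B : Matrix (Fin r) (Fin n) F)
    (u : Fin n → F[X]) :
    u ∈ hermitianDual q (generated (piretMatrix A B)) ↔
      (padRows κ B).mulVec (fun j => σ ((u j).coeff 0)) = 0 ∧
      ∀ m, A.mulVec (fun j => σ ((u j).coeff m)) +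
        (padRows κ B).mulVec (fun j => σ ((u j).coeff (m + 1))) = 0 := by
  rw [mem_hermitianDual_generated_piretMatrix hσ]
  have h0 : ∀ a, σ ((∑ j, (X * C (σ (A a j)) + C (σ (padRows κ B a j))) * u j).coeff 0) =
      (padRows κ B).mulVec (fun j => σ ((u j).coeff 0)) a := by
    intro a
    simp [Matrix.mulVec, dotProduct, hσσ, add_mul, mul_assoc]
  have h1 : ∀ a m, σ ((∑ j, (X * C (σ (A a j)) + C (σ (padRows κ B a j))) * u j).coeff (m + 1)) =
      (A.mulVec (fun j => σ ((u j).coeff m)) +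
        (padRows κ B).mulVec (fun j => σ ((u j).coeff (m + 1)))) a := by
    intro a m
    simp [Matrix.mulVec, dotProduct, hσσ, add_mul, mul_assoc, coeff_X_mul, Finset.sum_add_distrib]
  constructor
  · intro h
    refine ⟨funext fun a => ?_, fun m => funext fun a => ?_⟩
    · rw [← h0, h, coeff_zero, map_zero, Pi.zero_apply]
    · rw [← h1, h, coeff_zero, map_zero, Pi.zero_apply]
  · rintro ⟨h2, h3⟩ a
    ext m
    apply σ.injective
    rw [coeff_zero, map_zero]
    rcases m with _ | m
    · rw [h0, h2, Pi.zero_apply]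
    · rw [h1, h3, Pi.zero_apply]

theorem hasFreeDistance_hermitianDual [DecidableEq F] {q r : ℕ} (hr : r ≤ κ) {σ : F →+* F}
    (hσ : ∀ x, σ x = x ^ q) (hσσ : ∀ x, σ (σ x) = x)
    {A : Matrix (Fin κ) (Fin n) F} {B : Matrix (Fin r) (Fin n) F} {d₁ d₀ d : ℕ}
    (h₁ : ∀ c, A.mulVec c = 0 → c ≠ 0 → d₁ ≤ hammingNorm c)
    (h₀ : ∀ c, B.mulVec c = 0 → c ≠ 0 → d₀ ≤ hammingNorm c)
    (h₂ : ∀ c, A.mulVec c = 0 → B.mulVec c = 0 → c ≠ 0 → d ≤ hammingNorm c)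
    (hd : d ≤ d₁ + d₀)
    (hex : ∃ c, A.mulVec c = 0 ∧ B.mulVec c = 0 ∧ c ≠ 0 ∧ hammingNorm c ≤ d) :
    HasFreeDistance (hermitianDual q (generated (piretMatrix A B))) d := by
  have hlow : ∀ u ∈ hermitianDual q (generated (piretMatrix A B)), u ≠ 0 → d ≤ weight u := by
    intro u hu hu0
    obtain ⟨hz, hs⟩ := (mem_hermitianDual_iff_coeff hσ hσσ A B u).1 hu
    -- Conjugation by the involution `σ` preserves weights and turns the dual conditions into
    -- equations in `A` and `B` themselves.
    let v : ℕ → Fin n → F := fun m j => σ ((u j).coeff m)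
    let S : Finset ℕ := Finset.univ.biUnion fun j => (u j).support
    have hS : ∀ m, m ∈ S ↔ v m ≠ 0 := by
      intro m
      simp [S, v, funext_iff]
    have hne : S.Nonempty := by
      obtain ⟨j, hj⟩ := Function.ne_iff.1 hu0
      obtain ⟨m, hm⟩ := nonempty_support_iff.2 hj
      exact ⟨m, Finset.mem_biUnion.2 ⟨j, Finset.mem_univ j, hm⟩⟩
    have hlast : A.mulVec (v (S.max' hne)) = 0 := by
      have h3 : v (S.max' hne + 1) = 0 := by
        by_contra h
        have := S.le_max' _ ((hS _).2 h)
        omega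
      have h4 := hs (S.max' hne)
      change _ + (padRows κ B).mulVec (v (S.max' hne + 1)) = 0 at h4
      rwa [h3, Matrix.mulVec_zero, add_zero] at h4
    have hfirst : B.mulVec (v (S.min' hne)) = 0 := by
      apply mulVec_eq_zero_of_padRows hr
      rcases hm : S.min' hne with _ | m
      · exact hz
      · have h3 : v m = 0 := by
          by_contra h
          have := S.min'_le _ ((hS _).2 h)
          omega
        have h4 := hs m
        change A.mulVec (v m) + _ = 0 at h4
        rwa [h3, Matrix.mulVec_zero, zero_add] at h4
    have hmin := (hS _).1 (S.min'_mem hne)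
    have hmax := (hS _).1 (S.max'_mem hne)
    by_cases heq : S.min' hne = S.max' hne
    · have h3 := sum_hammingNorm_le_weight (σ := σ) u {S.max' hne}
      rw [Finset.sum_singleton] at h3
      exact (h₂ _ hlast (heq ▸ hfirst) hmax).trans h3
    · have h3 := sum_hammingNorm_le_weight (σ := σ) u {S.min' hne, S.max' hne}
      rw [Finset.sum_pair heq] at h3
      have h4 := h₀ _ hfirst hmin
      have h5 := h₁ _ hlast hmax
      refine le_trans ?_ h3
      change d ≤ hammingNorm (v (S.min' hne)) + hammingNorm (v (S.max' hne))
      omega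
  obtain ⟨c, hA, hB, hc0, hcd⟩ := hex
  let u : Fin n → F[X] := fun j => C (σ (c j))
  have hu : u ∈ hermitianDual q (generated (piretMatrix A B)) := by
    rw [mem_hermitianDual_iff_coeff hσ hσσ]
    have hpad : (padRows κ B).mulVec c = 0 := by
      rw [padRows_eq, ← Matrix.mulVec_mulVec, hB, Matrix.mulVec_zero]
    have hu0 : (fun j => σ ((u j).coeff 0)) = c := by
      funext j
      simp [u, hσσ]
    have hu1 : ∀ m, (fun j => σ ((u j).coeff (m + 1))) = 0 := by
      intro m
      funext j
      simp [u]
    refine ⟨by rw [hu0, hpad], fun m => ?_⟩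
    rw [hu1, Matrix.mulVec_zero, add_zero]
    rcases m with _ | m
    · rw [hu0, hA]
    · rw [hu1, Matrix.mulVec_zero]
  have hu0 : u ≠ 0 := by
    obtain ⟨j, hj⟩ := Function.ne_iff.1 hc0
    refine Function.ne_iff.2 ⟨j, ?_⟩
    simpa [u] using hj
  have hwt : weight u ≤ hammingNorm c := by
    unfold weight hammingNorm
    rw [Finset.card_filter]
    refine Finset.sum_le_sum fun j _ => ?_
    by_cases h : c j = 0
    · simp [u, h]
    · rw [if_pos h]
      simp [u, support_C, h]
  refine ⟨⟨u, hu, hu0, le_antisymm (hwt.trans hcd) (hlow u hu hu0)⟩, ?_⟩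
  rintro w ⟨u, hu, hu0, rfl⟩
  exact hlow u hu hu0

/-- Conjugating entries preserves the existence of a right inverse, so the kernel description
applies to the conjugates of `A` and `B`. -/
theorem exists_isGeneratorWith_hermitianDual {q r k : ℕ} (hr : r ≤ κ) (hr0 : 0 < r) (hk : r ≤ k)
    (hn : κ + k = n) {σ : F →+* F} (hσ : ∀ x, σ x = x ^ q)
    {A : Matrix (Fin κ) (Fin n) F} {B : Matrix (Fin r) (Fin n) F}
    (hAB : LinearIndependent F (Matrix.fromRows A B).row) :
    ∃ G : Matrix (Fin k) (Fin n) F[X],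
      IsGeneratorWith G (hermitianDual q (generated (piretMatrix A B))) r 1 := by
  obtain ⟨l, rfl⟩ := Nat.exists_eq_add_of_le hr
  obtain ⟨m, rfl⟩ := Nat.exists_eq_add_of_le hk
  have hli : LinearIndependent F (Matrix.fromRows (A.map σ) (B.map σ)).row := by
    obtain ⟨R, hR⟩ := exists_right_inverse _ hAB
    apply linearIndependent_row_of_mul_eq_one (T := R.map σ)
    rw [← Matrix.fromRows_map, ← Matrix.map_mul, hR]
    simp
  obtain ⟨A', B', hli', hgen⟩ := exists_generated_eq_kernel (A.map σ) (B.map σ) hli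
    (m := m) (by omega)
  have heq : hermitianDual q (generated (piretMatrix A B)) = generated (piretMatrix A' B') := by
    ext u
    rw [hgen, mem_hermitianDual_generated_piretMatrix hσ]
    simp only [map_padRows, Matrix.map_apply]
  rw [heq]
  exact ⟨_, isGeneratorWith_piretMatrix (Nat.le_add_right _ _) hr0 hli'⟩

end FreeDistance

/-! ### Frobenius and degrees of minimal polynomials. -/

section FiniteFields

variable {F K : Type*} [Field F] [Fintype F] [Field K] [Algebra F K]

theorem exists_algebraMap_of_pow_card_eq {x : K} (hx : x ^ Fintype.card F = x) :
    ∃ a : F, algebraMap F K a = x := by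
  classical
  by_contra! h
  have hne : (X ^ Fintype.card F - X : K[X]) ≠ 0 :=
    FiniteField.X_pow_card_sub_X_ne_zero K Fintype.one_lt_card
  have hsub : (insert x (Finset.univ.image (algebraMap F K))).val ⊆
      (X ^ Fintype.card F - X : K[X]).roots := by
    intro y hy
    rw [mem_roots hne, IsRoot.def, eval_sub, eval_pow, eval_X, sub_eq_zero]
    rw [Finset.mem_val, Finset.mem_insert, Finset.mem_image] at hy
    rcases hy with rfl | ⟨a, -, rfl⟩
    · exact hx
    · rw [← map_pow, FiniteField.pow_card]
  have h1 := card_le_degree_of_subset_roots hsub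
  rw [FiniteField.X_pow_card_sub_X_natDegree_eq K Fintype.one_lt_card,
    Finset.card_insert_of_notMem (by simpa using h),
    Finset.card_image_of_injective _ (algebraMap F K).injective, Finset.card_univ] at h1
  omega

theorem natDegree_minpoly_le_one {x : K} (hx : x ^ Fintype.card F = x) :
    (minpoly F x).natDegree ≤ 1 := by
  obtain ⟨a, rfl⟩ := exists_algebraMap_of_pow_card_eq hx
  rw [minpoly.eq_X_sub_C, natDegree_X_sub_C]

/-- With `Q = card F`, the conjugate `x ^ Q` is `-x⁻¹`, and `Q` odd makes Frobenius an involution on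
`x`. So the trace `a = x + x ^ Q` is in `F`, the norm is `-1`, and `x` is a root of `X ^ 2 - a X -
1`. -/
theorem natDegree_minpoly_le_two {x : K} (hodd : Odd (Fintype.card F))
    (hx : x ^ (Fintype.card F + 1) = -1) : (minpoly F x).natDegree ≤ 2 := by
  have hx0 : x ≠ 0 := by
    rintro rfl
    simp at hx
  have h1 : x ^ Fintype.card F = -x⁻¹ := by
    rw [pow_succ] at hx
    field_simp
    exact hx
  obtain ⟨a, ha⟩ : ∃ a : F, algebraMap F K a = x + x ^ Fintype.card F := by
    apply exists_algebraMap_of_pow_card_eq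
    have h2 := map_add (FiniteField.frobeniusAlgHom F K) x (x ^ Fintype.card F)
    simp only [FiniteField.coe_frobeniusAlgHom] at h2
    have h3 : (x ^ Fintype.card F) ^ Fintype.card F = x := by
      rw [h1, hodd.neg_pow, inv_pow, h1, inv_neg, inv_inv, neg_neg]
    rw [h2, h3, add_comm]
  have hdvd : minpoly F x ∣ X ^ 2 - C a * X - 1 := by
    rw [minpoly.dvd_iff]
    simp only [map_sub, map_mul, map_pow, aeval_X, aeval_C, ha, map_one]
    rw [pow_succ] at hx
    linear_combination -hx
  have hdeg : (X ^ 2 - C a * X - 1 : F[X]).natDegree = 2 := by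
    compute_degree!
  have hne : (X ^ 2 - C a * X - 1 : F[X]) ≠ 0 := by
    intro h
    rw [h, natDegree_zero] at hdeg
    omega
  exact (natDegree_le_of_dvd hdvd hne).trans hdeg.le

theorem aeval_pow_card (x : K) (p : F[X]) :
    aeval (x ^ Fintype.card F) p = (aeval x p) ^ Fintype.card F :=
  aeval_algHom_apply (FiniteField.frobeniusAlgHom F K) x p

theorem exists_ringHom_pow {q : ℕ} (hF : Fintype.card F = q ^ 2) :
    ∃ σ : F →+* F, (∀ x, σ x = x ^ q) ∧ ∀ x, σ (σ x) = x := by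
  obtain ⟨p, hp⟩ := CharP.exists F
  obtain ⟨m, hpp, hm⟩ := FiniteField.card F p
  have : Fact p.Prime := ⟨hpp⟩
  obtain ⟨l, -, rfl⟩ := (Nat.dvd_prime_pow hpp).1
    (show q ∣ p ^ (m : ℕ) by rw [← hm, hF]; exact dvd_pow_self q two_ne_zero)
  refine ⟨iterateFrobenius F p l, fun x => iterateFrobenius_def p l x, fun x => ?_⟩
  rw [iterateFrobenius_def, iterateFrobenius_def, ← pow_mul, ← sq, ← hF, FiniteField.pow_card]

end FiniteFields

/-! ### Distance and dimension for zeros symmetric under Frobenius. -/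

section SelfConjugate

variable {F K : Type*} [Field F] [Fintype F] [Field K] [Algebra F K] {n : ℕ}

/-- The BCH bound for a set of zeros completed by the conjugates over `F`. -/
theorem eq_zero_of_conjugate_zeros [DecidableEq F] {b ζ : K} (hb : b ≠ 0)
    (hbF : b ^ Fintype.card F = b) (hn : 0 < n) (hζ : IsPrimitiveRoot ζ n)
    (hζF : ζ ^ Fintype.card F = ζ⁻¹) {r : ℕ} {c : Fin n → F}
    (hc : ∀ t < r + 1, aeval (b * ζ ^ t) (wordPoly c) = 0) (hd : hammingNorm c ≤ 2 * r + 1) :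
    c = 0 := by
  have hζ0 : ζ ≠ 0 := hζ.ne_zero hn.ne'
  have hconj : ∀ t < r + 1, aeval (b * (ζ ^ t)⁻¹) (wordPoly c) = 0 := by
    intro t ht
    have h1 := aeval_pow_card (F := F) (b * ζ ^ t) (wordPoly c)
    rw [hc t ht, zero_pow Fintype.card_ne_zero, mul_pow, hbF, ← pow_mul, mul_comm t, pow_mul,
      hζF, inv_pow] at h1
    exact h1
  refine eq_zero_of_zeros (a := b * (ζ ^ r)⁻¹) (mul_ne_zero hb (inv_ne_zero (pow_ne_zero _ hζ0)))
    hζ (d := 2 * r + 1) (fun j hj => ?_) hd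
  rcases le_total j r with hjr | hjr
  · obtain ⟨t, rfl⟩ := Nat.exists_eq_add_of_le hjr
    have h2 : b * (ζ ^ (j + t))⁻¹ * ζ ^ j = b * (ζ ^ t)⁻¹ := by
      rw [pow_add]
      field_simp
    rw [h2]
    exact hconj t (by omega)
  · obtain ⟨t, rfl⟩ := Nat.exists_eq_add_of_le hjr
    have h2 : b * (ζ ^ r)⁻¹ * ζ ^ (r + t) = b * ζ ^ t := by
      rw [pow_add]
      field_simp
    rw [h2]
    exact hc t (by omega)

/-- The dimensions of the codes with zeros `b ζ ^ t` for `t < i`, for `t = i` and for `t ≤ i`. -/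
theorem finrank_codeOfZeros [DecidableEq F] [Algebra.IsIntegral F K] {b ζ : K}
    (hodd : Odd (Fintype.card F)) (hn : n = Fintype.card F + 1) (hb : b ≠ 0)
    (hbF : b ^ Fintype.card F = b) (hζ : IsPrimitiveRoot ζ n) (hζF : ζ ^ Fintype.card F = ζ⁻¹)
    (hpow : ∀ t, (b * ζ ^ t) ^ n = -1) {i : ℕ} (hi : 1 ≤ i) (hi' : 2 * i + 1 ≤ n) :
    Module.finrank F (codeOfZeros F n (fun t => b * ζ ^ t) (Finset.range i)) + (2 * i - 1) = n ∧
    Module.finrank F (codeOfZeros F n (fun t => b * ζ ^ t) {i}) + 2 = n ∧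
    Module.finrank F (codeOfZeros F n (fun t => b * ζ ^ t) (Finset.range (i + 1))) +
      (2 * i + 1) = n := by
  set ω : ℕ → K := fun t => b * ζ ^ t
  have hdeg : ∀ t, (minpoly F (ω t)).natDegree ≤ 2 := fun t =>
    natDegree_minpoly_le_two hodd (hn ▸ hpow t)
  have hdeg0 : (minpoly F (ω 0)).natDegree ≤ 1 := natDegree_minpoly_le_one (by simp [ω, hbF])
  have h1 : n ≤ Module.finrank F (codeOfZeros F n ω (Finset.range i)) + (2 * i - 1) := by
    refine (le_finrank_codeOfZeros ω _).trans (Nat.add_le_add_left ?_ _)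
    obtain ⟨i, rfl⟩ := Nat.exists_eq_add_of_le' hi
    rw [Finset.sum_range_succ']
    have := Finset.sum_le_card_nsmul (Finset.range i)
      (fun t => (minpoly F (ω (t + 1))).natDegree) 2 (fun t _ => hdeg _)
    rw [Finset.card_range, smul_eq_mul] at this
    omega
  have h0 : n ≤ Module.finrank F (codeOfZeros F n ω {i}) + 2 := by
    refine (le_finrank_codeOfZeros ω _).trans (Nat.add_le_add_left ?_ _)
    rw [Finset.sum_singleton]
    exact hdeg i
  have h2 : Module.finrank F (codeOfZeros F n ω (Finset.range (i + 1))) + (2 * i + 1) ≤ n := by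
    by_contra! h
    obtain ⟨c, hc, hc0, hwt⟩ := exists_hammingNorm_le (m := n - (2 * i + 1))
      (codeOfZeros F n ω (Finset.range (i + 1))) (by omega) (by omega)
    refine hc0 (eq_zero_of_conjugate_zeros (r := i) hb hbF (by omega) hζ hζF (fun t ht => ?_)
      (by omega))
    exact mem_codeOfZeros.1 hc t (Finset.mem_range.2 ht)
  -- The sum of the two codes has dimension at most `n`, so the codimensions of `C₁` and `C₀` add up
  -- to at least that of their intersection; with the three bounds above, all are equalities.
  have h3 := Submodule.finrank_sup_add_finrank_inf_eq (codeOfZeros F n ω (Finset.range i))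
    (codeOfZeros F n ω {i})
  rw [← codeOfZeros_insert, ← Finset.range_add_one] at h3
  have h4 := Submodule.finrank_le
    (codeOfZeros F n ω (Finset.range i) ⊔ codeOfZeros F n ω {i})
  rw [Module.finrank_fin_fun] at h4
  omega

end SelfConjugate

end ConvCode

/-! ### Assembly of the construction. -/

theorem theorem4 {F : Type*} [Field F] [Fintype F] (q n s i : ℕ)
    (hq : IsPrimePow q) (hq4 : q % 4 = 1) (hF : Fintype.card F = q ^ 2)
    (hn : n = q ^ 2 + 1) (hs : s = n / 2) (hi : 2 ≤ i) (hi' : i ≤ n / 2 - 1) :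
    ∃ W : Submodule F[X] (Fin n → F[X]),
      ConvCode.HasParameters W (n - 2 * i + 1) 2 1 (2 * i + 2) ∧
      ConvCode.IsMDS W ∧
      ∃ (β : AlgebraicClosure F) (H₁ : Matrix (Fin (2 * i - 1)) (Fin n) F)
        (H₀ : Matrix (Fin 2) (Fin n) F) (V : Submodule F[X] (Fin n → F[X])),
        IsPrimitiveRoot β (2 * n) ∧
        ConvCode.negacyclicBCH F n β s (i + 2) ⊆ ConvCode.negacyclicBCH F n β s (i + 1) ∧
        ConvCode.IsParityCheck H₁ (ConvCode.negacyclicBCH F n β s (i + 1)) ∧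
        ConvCode.IsParityCheck H₀ (ConvCode.negacyclicBCH F n β (s + 2 * i) 2) ∧
        ConvCode.IsParityCheck (Matrix.fromRows H₁ H₀)
          (ConvCode.negacyclicBCH F n β s (i + 2)) ∧
        ConvCode.IsGeneratorWith (ConvCode.piretMatrix H₁ H₀) V 2 1 ∧
        W = ConvCode.hermitianDual q V := by
  classical
  obtain ⟨e, he⟩ : ∃ e, q ^ 2 = 8 * e + 1 := by
    refine ⟨2 * (q / 4) ^ 2 + q / 4, ?_⟩
    have h1 : q = 4 * (q / 4) + 1 := by omega
    conv_lhs => rw [h1]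
    ring
  have hn' : n = 8 * e + 2 := by omega
  have hs' : s = 4 * e + 1 := by omega
  have hcard : Fintype.card F = 8 * e + 1 := hF.trans he
  have hne : NeZero ((2 * n : ℕ) : AlgebraicClosure F) := by
    have h1 : ((8 * e + 1 : ℕ) : AlgebraicClosure F) = 0 := by
      have h2 := congrArg (algebraMap F (AlgebraicClosure F)) (Nat.cast_card_eq_zero F)
      rwa [map_natCast, map_zero, hcard] at h2
    refine ⟨fun h => one_ne_zero (α := AlgebraicClosure F) ?_⟩
    push_cast at h h1
    rw [hn'] at h
    push_cast at h
    -- In `F`, `8e + 1 = 0`; this certificate writes `1` as a combination of `8e + 1` and `2n = 16e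
    -- + 4`.
    linear_combination (1 + 8 * (e : AlgebraicClosure F)) * h1 - 4 * (e : AlgebraicClosure F) * h
  obtain ⟨β, hβ⟩ := HasEnoughRootsOfUnity.exists_primitiveRoot (AlgebraicClosure F) (2 * n)
  have hn0 : 0 < n := by omega
  have hβ0 : β ≠ 0 := hβ.ne_zero (by omega)
  have hζ : IsPrimitiveRoot (β ^ 2) n := hβ.pow (by omega) rfl
  have hβn : β ^ n = -1 := by
    have h1 : (β ^ n) ^ 2 = 1 := by rw [← pow_mul, mul_comm n, hβ.pow_eq_one]
    rcases sq_eq_one_iff.1 h1 with h | h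
    · exact absurd (hβ.dvd_of_pow_eq_one _ h) (Nat.not_dvd_of_pos_of_lt hn0 (by omega))
    · exact h
  have hbF : (β ^ s) ^ Fintype.card F = β ^ s := by
    have h1 : s * Fintype.card F = 2 * n * (2 * e) + s := by
      rw [hcard, hn', hs']
      ring
    rw [← pow_mul, h1, pow_add, pow_mul, hβ.pow_eq_one, one_pow, one_mul]
  have hζF : (β ^ 2) ^ Fintype.card F = (β ^ 2)⁻¹ := by
    apply eq_inv_of_mul_eq_one_left
    rw [← pow_succ, hF, ← hn, hζ.pow_eq_one]
  have hb0 : β ^ s ≠ 0 := pow_ne_zero _ hβ0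
  let ω : ℕ → AlgebraicClosure F := fun t => β ^ s * (β ^ 2) ^ t
  have hω : ∀ t, β ^ (s + 2 * t) = ω t := fun t => by rw [pow_add, pow_mul]
  have hpow : ∀ t, ω t ^ n = -1 := by
    intro t
    rw [← hω, ← pow_mul, mul_comm, pow_mul, hβn]
    -- The exponent is `s + 2t` with `s = 4e + 1`, hence odd.
    exact Odd.neg_one_pow ⟨2 * e + t, by omega⟩
  obtain ⟨hd₁, hd₀, hd₂⟩ :
      Module.finrank F (ConvCode.codeOfZeros F n ω (Finset.range i)) + (2 * i - 1) = n ∧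
      Module.finrank F (ConvCode.codeOfZeros F n ω {i}) + 2 = n ∧
      Module.finrank F (ConvCode.codeOfZeros F n ω (Finset.range (i + 1))) + (2 * i + 1) = n :=
    ConvCode.finrank_codeOfZeros (i := i) (hcard ▸ ⟨4 * e, by ring⟩)
      (by rw [hF, hn]) hb0 hbF hζ hζF hpow (by omega) (by omega)
  have hC₁ : ConvCode.negacyclicBCH F n β s (i + 1) =
      ConvCode.codeOfZeros F n ω (Finset.range i) := by
    ext c
    rw [ConvCode.mem_negacyclicBCH fun t _ => by rw [hω, hpow], SetLike.mem_coe,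
      ConvCode.mem_codeOfZeros]
    simp [hω]
  have hC₂ : ConvCode.negacyclicBCH F n β s (i + 2) =
      ConvCode.codeOfZeros F n ω (Finset.range (i + 1)) := by
    ext c
    rw [ConvCode.mem_negacyclicBCH fun t _ => by rw [hω, hpow], SetLike.mem_coe,
      ConvCode.mem_codeOfZeros]
    simp [hω]
  have hC₀ : ConvCode.negacyclicBCH F n β (s + 2 * i) 2 = ConvCode.codeOfZeros F n ω {i} := by
    ext c
    rw [ConvCode.mem_negacyclicBCH fun t _ => by rw [add_assoc, ← mul_add, hω, hpow],
      SetLike.mem_coe, ConvCode.mem_codeOfZeros]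
    simp [hω]
  have hinf : ConvCode.codeOfZeros F n ω (Finset.range (i + 1)) =
      ConvCode.codeOfZeros F n ω (Finset.range i) ⊓ ConvCode.codeOfZeros F n ω {i} := by
    rw [Finset.range_add_one, ConvCode.codeOfZeros_insert]
  obtain ⟨H₁, hH₁⟩ := ConvCode.exists_isParityCheck _ hd₁
  obtain ⟨H₀, hH₀⟩ := ConvCode.exists_isParityCheck _ hd₀
  have hH := hH₁.fromRows hH₀ (congrArg SetLike.coe hinf) (by omega)
  obtain ⟨σ, hσ, hσσ⟩ := ConvCode.exists_ringHom_pow hF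
  have hgen := ConvCode.isGeneratorWith_piretMatrix (by omega) two_pos hH.1
  obtain ⟨G, hG⟩ := ConvCode.exists_isGeneratorWith_hermitianDual (k := n - 2 * i + 1)
    (by omega) two_pos (by omega) (by omega) hσ hH.1
  have hmem₁ : ∀ c, H₁.mulVec c = 0 → ∀ t < i, aeval (ω t) (ConvCode.wordPoly c) = 0 := by
    intro c hc t ht
    exact ConvCode.mem_codeOfZeros.1 ((hH₁.2 c).2 hc) t (Finset.mem_range.2 ht)
  have hmem₀ : ∀ c, H₀.mulVec c = 0 → aeval (ω i) (ConvCode.wordPoly c) = 0 := by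
    intro c hc
    exact ConvCode.mem_codeOfZeros.1 ((hH₀.2 c).2 hc) i (Finset.mem_singleton_self i)
  have hdist : ConvCode.HasFreeDistance (ConvCode.hermitianDual q
      (ConvCode.generated (ConvCode.piretMatrix H₁ H₀))) (2 * i + 2) := by
    refine ConvCode.hasFreeDistance_hermitianDual (d₁ := 2 * i) (d₀ := 2) (by omega) hσ hσσ
      ?_ ?_ ?_ le_rfl ?_
    · intro c hc hc0
      by_contra! h
      refine hc0 (ConvCode.eq_zero_of_conjugate_zeros (r := i - 1) hb0 hbF hn0 hζ hζF
        (fun t ht => hmem₁ c hc t (by omega)) (by omega))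
    · intro c hc hc0
      by_contra! h
      refine hc0 (ConvCode.eq_zero_of_zeros (d := 1) (a := ω i) ?_ hζ (fun j hj => ?_) (by omega))
      · exact mul_ne_zero hb0 (pow_ne_zero _ (pow_ne_zero _ hβ0))
      · rw [Nat.lt_one_iff.1 hj, pow_zero, mul_one]
        exact hmem₀ c hc
    · intro c hc hc' hc0
      by_contra! h
      refine hc0 (ConvCode.eq_zero_of_conjugate_zeros (r := i) hb0 hbF hn0 hζ hζF
        (fun t ht => ?_) (by omega))
      rcases Nat.lt_succ_iff_lt_or_eq.1 ht with h1 | rfl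
      · exact hmem₁ c hc t h1
      · exact hmem₀ c hc'
    -- `C₂` has dimension `n - 2i - 1 = m + 1`, so the Singleton bound yields weight at most `2i +
    -- 2`.
    · obtain ⟨c, hc, hc0, hwt⟩ := ConvCode.exists_hammingNorm_le (m := n - (2 * i + 2))
        (ConvCode.codeOfZeros F n ω (Finset.range (i + 1))) (by omega) (by omega)
      rw [hinf] at hc
      exact ⟨c, (hH₁.2 c).1 hc.1, (hH₀.2 c).1 hc.2, hc0, by omega⟩
  have hparam : ConvCode.HasParameters (ConvCode.hermitianDual q
      (ConvCode.generated (ConvCode.piretMatrix H₁ H₀))) (n - 2 * i + 1) 2 1 (2 * i + 2) :=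
    ⟨⟨G, hG⟩, hdist⟩
  refine ⟨_, hparam, ⟨_, _, _, _, hparam, ?_⟩, β, H₁, H₀, _, hβ, ?_, ?_, ?_, ?_, hgen, rfl⟩
  -- Here `k = n - 2i + 1 ≥ 3`, so `⌊2 / k⌋ = 0` and the bound reads `(2i - 1) + 2 + 1`.
  · rw [Nat.div_eq_of_lt (by omega)]
    omega
  · rw [hC₁, hC₂, hinf]
    exact fun c hc => hc.1
  · rwa [hC₁]
  · rwa [hC₀]
  · rwa [hC₂]
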